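/- Let $d\ge 1$, $n\ge 1$, $m\ge 1$ be integers, let $\|\cdot\|$ be the Euclidean norm and $\lambda$ the Lebesgue measure on $\mathbb R^d$, and let $V_d$ be the volume of the unit ball. **Data.** Let $(X_1,Y_1),\dots,(X_n,Y_n)$ be i.i.d. with law $P$ on $\mathbb R^d\times\mathbb R$, whose first marginal is denoted $P^X$. Let the prototypes $Z_1,\dots,Z_m$ be i.i.d. with law $P^X$, the sample $(Z_j)_j$ being independent of the sample $(X_i,Y_i)_i$. Let $S_X\subset\mathbb R^d$ be a Borel set on which $X$ takes its values almost surely. Assume: * (covariates) $S_X\subset B(0,\rho_0)$ for some $\rho_0>0$; there are $c_d,T_0>0$ with $\lambda(S_X\cap B(x,\tau))\ge c_d\,\lambda(B(x,\tau))$ for all $x\in S_X$ and $\tau\in(0,T_0]$; and $P^X$ has a density $f_X$ on $S_X$ with $b\le f_X\le M$ there, where $0<b\le M<\infty$; * (regression function) $Y$ is integrable and $g(x)=\mathbb E[Y\mid X=x]$ is $L$-Lipschitz on $S_X$; * (noise) the variables $\varepsilon_i=Y_i-g(X_i)$ are sub-Gaussian with parameter $\sigma^2$ conditionally on $X_i$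 and $Z=(Z_1,\dots,Z_m)$, that is, $\mathbb E[\varepsilon_i\mid X_i,Z]=0$ and $\mathbb E[e^{t\varepsilon_i}\mid X_i,Z]\le e^{\sigma^2t^2/2}$ almost surely, for all $t\in\mathbb R$. **The estimator.** Let $\eta>0$, and let $Z(\eta)$ be a maximal $\eta$-net of $\{Z_1,\dots,Z_m\}$, chosen as a measurable function of $(Z_1,\dots,Z_m)$: a subset in which any two distinct points are at distance $>\eta$, and which is maximal with this property. For $x\in S_X$ let $\mathcal V_\eta(x)$ be the Voronoi cell of $x$, the set of all points of $S_X$ that have the same nearest neighbor in $Z(\eta)$ as $x$ (ties being broken in favor of the larger index). The OptiNet estimator is $$\hat g_{\mathrm{opt}}(x)=\frac{\sum_{i=1}^n Y_i\,\mathbf 1_{\mathcal V_\eta(x)}(X_i)}{\sum_{i=1}^n \mathbf 1_{\mathcal V_\eta(x)}(X_i)},\qquad \tfrac00=0 .$$ Let $L(\mathcal V_\eta(x))\le L$ be the smallest Lipschitz constant of $g$ over $\mathcal V_\eta(x)$. **Theorem.** Suppose that $\delta\in(0,1/4)$ and $$32\,d\log(12m/\delta)\le T_0^d\, m\, b\,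 c_d V_d,\qquad \eta\le 2T_0,\qquad n\,b\,V_d\,c_d\,\eta^d\ge 2^{d+3}\log(1/\delta).$$ Then for every $x\in S_X$, with probability at least $1-4\delta$, $$|\hat g_{\mathrm{opt}}(x)-g(x)|\le\sqrt{\frac{2^{d+2}\sigma^2\log(1/\delta)}{n\,b\,V_d\,c_d\,\eta^d}}+2L(\mathcal V_\eta(x))\left\{\eta+\left(\frac{32\,d\log(12m/\delta)}{m\,b\,c_dV_d}\right)^{1/d}\right\}.$$ -/

import Mathlib

open MeasureTheory ProbabilityTheory

namespace OptiNet

/-- `g` is (a version of) the regression function `x ↦ E[Y | X = x]` when `(X, Y)` has law `P`. -/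
def IsRegressionFunction {d : ℕ} (P : Measure (EuclideanSpace ℝ (Fin d) × ℝ))
    (g : EuclideanSpace ℝ (Fin d) → ℝ) : Prop :=
  Integrable (fun p => p.2) P ∧
    P[fun p => p.2 | MeasurableSpace.comap Prod.fst inferInstance] =ᵐ[P] fun p => g p.1

/-- `ε` is sub-Gaussian with parameter `σ²` conditionally on the σ-algebra `m`:
`E[ε | m] = 0` and `E[exp (t ε) | m] ≤ exp (σ² t² / 2)` almost surely, for every real `t`.
The integrability requirements make the conditional expectations genuine ones. -/
def CondSubGaussian {Ω : Type*} [MeasurableSpace Ω] (μ : Measure Ω) (m : MeasurableSpace Ω)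
    (ε : Ω → ℝ) (σ : ℝ) : Prop :=
  Integrable ε μ ∧ μ[ε | m] =ᵐ[μ] 0 ∧
    ∀ t : ℝ, Integrable (fun ω => Real.exp (t * ε ω)) μ ∧
      μ[fun ω => Real.exp (t * ε ω) | m] ≤ᵐ[μ] fun _ => Real.exp (σ ^ 2 * t ^ 2 / 2)

/-- The assumption on the law `PX` of the covariates and on their (Borel, bounded) domain `S`:
the volume of `S ∩ B(x, τ)` is at least `c` times that of `B(x, τ)` for `x ∈ S`, `0 < τ ≤ T₀`, and
`PX` has a density `f` on `S` with `b ≤ f ≤ M` there. -/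
structure CovariateAssumption {d : ℕ} (PX : Measure (EuclideanSpace ℝ (Fin d)))
    (S : Set (EuclideanSpace ℝ (Fin d))) (ρ₀ c T₀ b M : ℝ)
    (f : EuclideanSpace ℝ (Fin d) → ℝ) : Prop where
  measurableSet : MeasurableSet S
  radius_pos : 0 < ρ₀
  subset_ball : S ⊆ Metric.ball 0 ρ₀
  c_pos : 0 < c
  T₀_pos : 0 < T₀
  volume_inter_ball : ∀ x ∈ S, ∀ τ : ℝ, 0 < τ → τ ≤ T₀ →
    c * volume.real (Metric.ball x τ) ≤ volume.real (S ∩ Metric.ball x τ)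
  b_pos : 0 < b
  b_le_M : b ≤ M
  measurable_density : Measurable f
  density_bounds : ∀ x ∈ S, b ≤ f x ∧ f x ≤ M
  law_eq : PX = (volume.restrict S).withDensity fun x => ENNReal.ofReal (f x)

/-- The points `z i`, `i ∈ I`, form a maximal `η`-net of `z 0, …, z (m - 1)`: distinct selected
points are at distance larger than `η`, and `I` is maximal with this property. -/
def IsMaximalNet {d m : ℕ} (η : ℝ) (z : Fin m → EuclideanSpace ℝ (Fin d))
    (I : Finset (Fin m)) : Prop :=
  Maximal (fun J : Finset (Fin m) => ∀ i ∈ J, ∀ j ∈ J, i ≠ j → η < ‖z i - z j‖) I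

/-- `k` is the index of the nearest neighbor of `x` among the `z j`, `j ∈ I`, ties being broken in
favor of the larger index. -/
def IsNearestIndex {d m : ℕ} (z : Fin m → EuclideanSpace ℝ (Fin d)) (I : Finset (Fin m))
    (x : EuclideanSpace ℝ (Fin d)) (k : Fin m) : Prop :=
  k ∈ I ∧ ∀ j ∈ I, ‖x - z k‖ < ‖x - z j‖ ∨ (‖x - z k‖ = ‖x - z j‖ ∧ j ≤ k)

/-- The Voronoi cell of `x` in `S` with respect to the points `z j`, `j ∈ I`: all the points of `S`
that have the same nearest neighbor as `x`. -/
def voronoiCell {d m : ℕ} (S : Set (EuclideanSpace ℝ (Fin d)))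
    (z : Fin m → EuclideanSpace ℝ (Fin d)) (I : Finset (Fin m))
    (x : EuclideanSpace ℝ (Fin d)) : Set (EuclideanSpace ℝ (Fin d)) :=
  {y | y ∈ S ∧ ∃ k, IsNearestIndex z I x k ∧ IsNearestIndex z I y k}

/-- The average of the labels `y i` whose covariates `x i` fall in `V` (with `0 / 0 = 0`). -/
noncomputable def localAverage {d n : ℕ} (x : Fin n → EuclideanSpace ℝ (Fin d)) (y : Fin n → ℝ)
    (V : Set (EuclideanSpace ℝ (Fin d))) : ℝ :=
  (∑ i, V.indicator (fun _ => y i) (x i)) / ∑ i, V.indicator (fun _ => (1 : ℝ)) (x i)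

/-- The smallest Lipschitz constant of `g` over `V`. -/
noncomputable def lipConst {d : ℕ} (g : EuclideanSpace ℝ (Fin d) → ℝ)
    (V : Set (EuclideanSpace ℝ (Fin d))) : ℝ :=
  sInf {K : ℝ | 0 ≤ K ∧ ∀ x ∈ V, ∀ y ∈ V, |g x - g y| ≤ K * ‖x - y‖}

/-- The volume of the unit ball of `ℝ^d`. -/
noncomputable def unitBallVolume (d : ℕ) : ℝ :=
  volume.real (Metric.ball (0 : EuclideanSpace ℝ (Fin d)) 1)

end OptiNet

/-! Since the sample is independent of the prototypes, the joint law is a product. One can thus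
freeze the prototypes `z`, treat the cell `V` of `x` as deterministic, and integrate over `z` at the
end (`exists_measurableSet_count_and_noise`).

Variance: net points are more than `η` apart, so the cell contains `S ∩ B(z_k, η/2)`, where `z_k` is
the net point nearest to `x`. Its mass is at least `p = b c V_d (η/2)^d`, whence the factor `2^d`. A
Chernoff bound leaves at least `n p / 2` observations in `V` except with probability `δ`
(`measure_countIn_lt_le`). The noise summed over a random number `N` of observations is at most
`√(2σ²N log(1/δ))` except with probability `2δ` (`measure_sqrt_countIn_lt_abs_sum_le`). Dividing by
`N ≥ n p / 2` gives the first term.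

Bias: except with probability `δ`, every point of `S` is within `τ` of a prototype
(`CovariateAssumption.measure_not_cover_le`), hence within `η + τ` of its nearest net point. Two
points of one cell are then at distance at most `2(η + τ)`, and the Lipschitz constant on the cell
gives the second term. -/

namespace OptiNet

/-! ### Chernoff bounds for counts and for self-normalized noise sums. -/

section Concentration

/-- Exponential Markov inequality. The measure is arbitrary so that it can be a restriction of the
sample law. -/
lemma measure_ge_le_of_lintegral_exp_le {β : Type*} [MeasurableSpace β] {ν : Measure β}
    {W : β → ℝ} (hW : Measurable W) {s a : ℝ} (hs : 0 ≤ s) {B : ENNReal}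
    (h : ∫⁻ x, ENNReal.ofReal (Real.exp (s * W x)) ∂ν ≤ B) :
    ν {x | a ≤ W x} ≤ ENNReal.ofReal (Real.exp (-(s * a))) * B := by
  have h1 := mul_meas_ge_le_lintegral₀ (μ := ν)
    (f := fun x => ENNReal.ofReal (Real.exp (s * W x))) (by fun_prop)
    (ENNReal.ofReal (Real.exp (s * a)))
  have h2 : ν {x | a ≤ W x} ≤ ν {x | ENNReal.ofReal (Real.exp (s * a)) ≤
      ENNReal.ofReal (Real.exp (s * W x))} := by
    refine measure_mono fun x hx => ENNReal.ofReal_le_ofReal (Real.exp_le_exp.2 ?_)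
    exact mul_le_mul_of_nonneg_left hx hs
  calc ν {x | a ≤ W x}
      = ENNReal.ofReal (Real.exp (-(s * a))) *
          (ENNReal.ofReal (Real.exp (s * a)) * ν {x | a ≤ W x}) := by
        rw [← mul_assoc, ← ENNReal.ofReal_mul (Real.exp_nonneg _), ← Real.exp_add]
        simp
    _ ≤ _ := by gcongr; exact (mul_le_mul_right h2 _).trans (h1.trans h)

/-- The Chernoff bound for a variable that is sub-Gaussian with variance proxy `v` under a measure
of total mass at most `q`. -/
lemma measure_lt_le_of_subGaussian {β : Type*} [MeasurableSpace β] {ν : Measure β}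
    {W : β → ℝ} (hW : Measurable W) {q : ENNReal} (hq : q ≠ ⊤) {v l : ℝ} (hv : 0 ≤ v)
    (hl : 0 ≤ l)
    (h : ∀ s : ℝ, 0 ≤ s → ∫⁻ x, ENNReal.ofReal (Real.exp (s * W x)) ∂ν ≤
      ENNReal.ofReal (Real.exp (s ^ 2 * v / 2)) * q) :
    ν {x | √(2 * v * l) < W x} ≤ ENNReal.ofReal (Real.exp (-l)) * q := by
  rcases hv.eq_or_lt with rfl | hv
  -- When `v = 0` no `s` is optimal: letting `s → ∞` in Markov's inequality shows that `{W > 0}` is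
  -- null.
  · have key : ∀ j : ℕ, ν {x | 1 / ((j : ℝ) + 1) ≤ W x} = 0 := by
      intro j
      have hlim : Filter.Tendsto
          (fun k : ℕ => ENNReal.ofReal (Real.exp (-((k : ℝ) * (1 / ((j : ℝ) + 1))))) * q)
          Filter.atTop (nhds (ENNReal.ofReal 0 * q)) := by
        refine ENNReal.Tendsto.mul_const ?_ (Or.inr hq)
        refine ENNReal.tendsto_ofReal (Real.tendsto_exp_neg_atTop_nhds_zero.comp ?_)
        exact tendsto_natCast_atTop_atTop.atTop_mul_const (by positivity)
      rw [ENNReal.ofReal_zero, zero_mul] at hlim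
      refine le_antisymm (ge_of_tendsto' hlim fun k => ?_) bot_le
      refine measure_ge_le_of_lintegral_exp_le hW (Nat.cast_nonneg k) ?_
      simpa using h k (Nat.cast_nonneg k)
    have h0 : ν (⋃ j : ℕ, {x | 1 / ((j : ℝ) + 1) ≤ W x}) = 0 := measure_iUnion_null key
    refine (measure_mono_null (fun x hx => ?_) h0).le.trans bot_le
    simp only [mul_zero, zero_mul, Real.sqrt_zero, Set.mem_ofPred_eq] at hx
    obtain ⟨j, hj⟩ := exists_nat_one_div_lt hx
    exact Set.mem_iUnion.2 ⟨j, hj.le⟩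
  -- This `s` minimizes the exponent `s² v / 2 - s √(2vl)`, with minimal value `-l`.
  · set s := √(2 * l / v) with hs
    have hs2 : s ^ 2 = 2 * l / v := Real.sq_sqrt (by positivity)
    have hsa : s * √(2 * v * l) = 2 * l := by
      rw [hs, ← Real.sqrt_mul (by positivity),
        show 2 * l / v * (2 * v * l) = (2 * l) ^ 2 by field_simp]
      exact Real.sqrt_sq (by positivity)
    calc ν {x | √(2 * v * l) < W x} ≤ ν {x | √(2 * v * l) ≤ W x} :=
          measure_mono fun w hw => by rw [Set.mem_ofPred_eq] at hw ⊢; linarith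
      _ ≤ ENNReal.ofReal (Real.exp (-(s * √(2 * v * l)))) *
          (ENNReal.ofReal (Real.exp (s ^ 2 * v / 2)) * q) :=
        measure_ge_le_of_lintegral_exp_le hW (Real.sqrt_nonneg _) (h s (Real.sqrt_nonneg _))
      _ = _ := by
        rw [← mul_assoc, ← ENNReal.ofReal_mul (Real.exp_nonneg _), ← Real.exp_add, hsa, hs2]
        congr 3
        field_simp
        ring

variable {α : Type*} [MeasurableSpace α] {P : Measure α} [IsProbabilityMeasure P] {n : ℕ}

lemma lintegral_pi_prod (F : Fin n → α → ENNReal) (hF : ∀ i, Measurable (F i)) :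
    ∫⁻ w, ∏ i, F i (w i) ∂(Measure.pi fun _ : Fin n => P) = ∏ i, ∫⁻ x, F i x ∂P := by
  refine (lintegral_prod_eq_prod_lintegral_of_indepFun Finset.univ
    (fun i (w : Fin n → α) => F i (w i)) (iIndepFun_pi fun i => (hF i).aemeasurable)
    fun i => (hF i).comp (measurable_pi_apply i)).trans ?_
  refine Finset.prod_congr rfl fun i _ => ?_
  exact (measurePreserving_eval (fun _ : Fin n => P) i).lintegral_comp (hF i)

/-- The number of the points `w i` that lie in `C`, as a real number. -/
noncomputable def countIn (C : Set α) (w : Fin n → α) : ℝ :=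
  ∑ i, C.indicator (fun _ => (1 : ℝ)) (w i)

lemma measurable_countIn {C : Set α} (hC : MeasurableSet C) :
    Measurable (countIn C : (Fin n → α) → ℝ) :=
  Finset.measurable_sum _ fun i _ =>
    (measurable_const.indicator hC).comp (measurable_pi_apply i)

/-- A lower-tail bound for the binomial count of the points falling in a set. -/
lemma measure_countIn_lt_le {C : Set α} (hC : MeasurableSet C) {p : ℝ} (hp : 0 ≤ p)
    (hpC : ENNReal.ofReal p ≤ P C) :
    (Measure.pi fun _ : Fin n => P) {w | countIn C w < n * p / 2} ≤
      ENNReal.ofReal (Real.exp (-(n * p / 8))) := by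
  have hpr : p ≤ P.real C := (ENNReal.ofReal_le_iff_le_toReal (measure_ne_top _ _)).1 hpC
  -- With `s = log 2`, one observation contributes `E[exp(-s 1_C)] = 1 - P(C)/2 ≤ exp(-p/2)`. The
  -- final exponent `n p (s - 1)/2` is at most `-n p / 8` because `log 2 ≤ 3/4`.
  set s := Real.log 2
  have hs : 0 ≤ s := Real.log_nonneg (by norm_num)
  have hexp : Real.exp (-s) = 1 / 2 := by
    rw [Real.exp_neg, Real.exp_log (by norm_num)]; norm_num
  have hone : ∫⁻ x, ENNReal.ofReal (Real.exp (s * -C.indicator (fun _ => (1 : ℝ)) x)) ∂P ≤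
      ENNReal.ofReal (Real.exp (-(p / 2))) := by
    have hfun : ∀ x, ENNReal.ofReal (Real.exp (s * -C.indicator (fun _ => (1 : ℝ)) x)) =
        C.indicator (fun _ => ENNReal.ofReal (1 / 2)) x + Cᶜ.indicator (fun _ => 1) x := by
      intro x
      by_cases hx : x ∈ C
      · simp only [hx, Set.indicator_of_mem, Set.mem_compl_iff, not_true_eq_false,
          not_false_eq_true, Set.indicator_of_notMem, add_zero, mul_neg, mul_one, hexp]
      · simp [hx]
    simp_rw [hfun]
    rw [lintegral_add_left (measurable_const.indicator hC), lintegral_indicator_const hC,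
      lintegral_indicator_const hC.compl, one_mul, ← ofReal_measureReal, ← ofReal_measureReal,
      ← ENNReal.ofReal_mul (by norm_num), ← ENNReal.ofReal_add (by positivity) (by positivity),
      probReal_compl_eq_one_sub hC]
    refine ENNReal.ofReal_le_ofReal ?_
    have := Real.one_sub_le_exp_neg (p / 2)
    linarith
  have hint : ∫⁻ w, ENNReal.ofReal (Real.exp (s * -countIn C w))
      ∂(Measure.pi fun _ : Fin n => P) ≤ ENNReal.ofReal (Real.exp (-(n * p / 2))) := by
    have : ∀ w : Fin n → α, ENNReal.ofReal (Real.exp (s * -countIn C w)) =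
        ∏ i, ENNReal.ofReal (Real.exp (s * -C.indicator (fun _ => (1 : ℝ)) (w i))) := by
      intro w
      rw [← ENNReal.ofReal_prod_of_nonneg fun i _ => Real.exp_nonneg _, ← Real.exp_sum,
        countIn, ← Finset.mul_sum, Finset.sum_neg_distrib]
    simp_rw [this]
    rw [lintegral_pi_prod
      (fun _ x => ENNReal.ofReal (Real.exp (s * -C.indicator (fun _ => (1 : ℝ)) x)))
      fun i => by
        have : Measurable (C.indicator fun _ => (1 : ℝ)) := measurable_const.indicator hC
        fun_prop]
    refine (Finset.prod_le_prod' fun i _ => hone).trans_eq ?_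
    rw [Finset.prod_const, Finset.card_univ, Fintype.card_fin, ← ENNReal.ofReal_pow
      (Real.exp_nonneg _), ← Real.exp_nat_mul]
    ring_nf
  calc (Measure.pi fun _ : Fin n => P) {w | countIn C w < n * p / 2}
      ≤ (Measure.pi fun _ : Fin n => P) {w | -(n * p / 2) ≤ -countIn C w} :=
        measure_mono fun w hw => by rw [Set.mem_ofPred_eq] at hw ⊢; linarith
    _ ≤ _ := measure_ge_le_of_lintegral_exp_le (measurable_countIn hC).neg hs hint
    _ ≤ _ := by
      rw [← ENNReal.ofReal_mul (Real.exp_nonneg _), ← Real.exp_add]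
      refine ENNReal.ofReal_le_ofReal (Real.exp_le_exp.2 ?_)
      have h2 : s ≤ 3 / 4 := by have := Real.log_two_lt_d9; simp only [s]; linarith
      have : (0 : ℝ) ≤ n * p := by positivity
      nlinarith

/-- A one-sided self-normalized bound for a sum of noise terms over the points falling in `C`. -/
lemma measure_sqrt_countIn_lt_sum_le {C : Set α} (hC : MeasurableSet C) {e : α → ℝ}
    (he : Measurable e) {σ l : ℝ} (hl : 0 ≤ l)
    (h : ∀ t : ℝ, ∫⁻ x in C, ENNReal.ofReal (Real.exp (t * e x)) ∂P ≤
      ENNReal.ofReal (Real.exp (σ ^ 2 * t ^ 2 / 2)) * P C) :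
    (Measure.pi fun _ : Fin n => P)
        {w | √(2 * (σ ^ 2 * countIn C w) * l) < ∑ i, C.indicator e (w i)} ≤
      ENNReal.ofReal (Real.exp (-l)) := by
  classical
  set Q := Measure.pi fun _ : Fin n => P
  -- The sample space is partitioned according to the set `A` of indices whose points fall in `C`.
  -- On each piece the count is the constant `A.card`, so the threshold is deterministic and the
  -- ordinary Chernoff bound applies to the restricted measure. The pieces are disjoint, so summing
  -- their bounds costs no union-bound factor.
  let D : Finset (Fin n) → Fin n → Set α := fun A i => if i ∈ A then C else Cᶜ
  let conf : Finset (Fin n) → Set (Fin n → α) := fun A => Set.univ.pi (D A)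
  have hD : ∀ A i, MeasurableSet (D A i) := fun A i => by
    simp only [D]; split_ifs; exacts [hC, hC.compl]
  have hconf : ∀ A, MeasurableSet (conf A) := fun A => .univ_pi (hD A)
  have hmem : ∀ A, ∀ w ∈ conf A, ∀ i, w i ∈ C ↔ i ∈ A := by
    intro A w hw i
    have := hw i trivial
    by_cases hi : i ∈ A <;> simp_all [D]
  have hdisj : Pairwise (Function.onFun Disjoint conf) := by
    intro A B hAB
    refine Set.disjoint_left.2 fun w hA hB => hAB ?_
    ext i
    rw [← hmem A w hA i, hmem B w hB i]
  have hcover : ⋃ A, conf A = Set.univ := by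
    refine Set.eq_univ_of_forall fun w => Set.mem_iUnion.2
      ⟨Finset.univ.filter fun i => w i ∈ C, fun i _ => ?_⟩
    by_cases hi : w i ∈ C <;> simp [D, hi]
  set bad := {w : Fin n → α | √(2 * (σ ^ 2 * countIn C w) * l) < ∑ i, C.indicator e (w i)}
  have hWm : Measurable fun w : Fin n → α => ∑ i, C.indicator e (w i) :=
    Finset.measurable_sum _ fun i _ => (he.indicator hC).comp (measurable_pi_apply i)
  have hbadm : MeasurableSet bad :=
    measurableSet_lt (by have := measurable_countIn (n := n) hC; fun_prop) hWm
  have hsum : ∀ B, MeasurableSet B → Q B = ∑ A, Q (B ∩ conf A) := by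
    intro B hB
    rw [← tsum_fintype (L := .unconditional _) (fun A => Q (B ∩ conf A)), ← measure_iUnion
      (fun A A' hA => (hdisj hA).mono Set.inter_subset_right Set.inter_subset_right)
      (fun A => hB.inter (hconf A)), ← Set.inter_iUnion, hcover, Set.inter_univ]
  have hA : ∀ A, Q (bad ∩ conf A) ≤ ENNReal.ofReal (Real.exp (-l)) * Q (conf A) := by
    intro A
    have hcount : ∀ w ∈ conf A, countIn C w = A.card := by
      intro w hw
      simp [countIn, Set.indicator_apply, hmem A w hw]
    have hq : Q (conf A) = ∏ i, P (D A i) := Measure.pi_pi _ _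
    rw [show bad ∩ conf A =
        {w | √(2 * (σ ^ 2 * A.card) * l) < ∑ i, C.indicator e (w i)} ∩ conf A by
      ext w
      simp only [Set.mem_inter_iff, and_congr_left_iff]
      intro hw
      simp only [bad, Set.mem_ofPred_eq, hcount w hw], ← Measure.restrict_apply' (hconf A)]
    refine measure_lt_le_of_subGaussian hWm (measure_ne_top _ _) (by positivity) hl
      fun s _ => ?_
    rw [← lintegral_indicator (hconf A)]
    have hfun : ∀ w, (conf A).indicator
        (fun w => ENNReal.ofReal (Real.exp (s * ∑ i, C.indicator e (w i)))) w ≤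
        ∏ i, (D A i).indicator
          (fun x => ENNReal.ofReal (Real.exp (s * C.indicator e x))) (w i) := by
      intro w
      by_cases hw : w ∈ conf A
      · rw [Set.indicator_of_mem hw, Finset.mul_sum, Real.exp_sum,
          ENNReal.ofReal_prod_of_nonneg fun i _ => Real.exp_nonneg _]
        exact (Finset.prod_congr rfl fun i _ => by rw [Set.indicator_of_mem (hw i trivial)]).le
      · rw [Set.indicator_of_notMem hw]; exact bot_le
    refine (lintegral_mono hfun).trans ?_
    rw [lintegral_pi_prod _ fun i => Measurable.indicator (by
      have := he.indicator hC
      fun_prop) (hD A i), hq]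
    -- Only the factors with `i ∈ A` carry noise; the others contribute just the mass of `Cᶜ`.
    have hone : ∀ i, ∫⁻ x, (D A i).indicator
        (fun x => ENNReal.ofReal (Real.exp (s * C.indicator e x))) x ∂P ≤
        (if i ∈ A then ENNReal.ofReal (Real.exp (σ ^ 2 * s ^ 2 / 2)) else 1) * P (D A i) := by
      intro i
      rw [lintegral_indicator (hD A i)]
      by_cases hi : i ∈ A
      · simp only [D, hi, if_true]
        refine le_trans (le_of_eq (setLIntegral_congr_fun hC fun x hx => ?_)) (h s)
        simp only [Set.indicator_of_mem hx]
      · simp only [D, hi, if_false, one_mul]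
        rw [setLIntegral_congr_fun (g := fun _ => 1) hC.compl fun x hx => by
          simp only [Set.indicator_of_notMem hx, mul_zero, Real.exp_zero, ENNReal.ofReal_one]]
        simp
    refine (Finset.prod_le_prod' fun i _ => hone i).trans_eq ?_
    rw [Finset.prod_mul_distrib, Finset.prod_ite_mem, Finset.univ_inter, Finset.prod_const,
      ← ENNReal.ofReal_pow (Real.exp_nonneg _), ← Real.exp_nat_mul]
    ring_nf
  calc Q bad = ∑ A, Q (bad ∩ conf A) := hsum _ hbadm
    _ ≤ ∑ A, ENNReal.ofReal (Real.exp (-l)) * Q (conf A) := Finset.sum_le_sum fun A _ => hA A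
    _ = ENNReal.ofReal (Real.exp (-l)) * Q Set.univ := by
      rw [← Finset.mul_sum, hsum _ .univ]; simp
    _ = _ := by simp [Q]

/-- The self-normalized bound for the absolute value of a sum of noise terms. -/
lemma measure_sqrt_countIn_lt_abs_sum_le {C : Set α} (hC : MeasurableSet C) {e : α → ℝ}
    (he : Measurable e) {σ l : ℝ} (hl : 0 ≤ l)
    (h : ∀ t : ℝ, ∫⁻ x in C, ENNReal.ofReal (Real.exp (t * e x)) ∂P ≤
      ENNReal.ofReal (Real.exp (σ ^ 2 * t ^ 2 / 2)) * P C) :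
    (Measure.pi fun _ : Fin n => P)
        {w | √(2 * (σ ^ 2 * countIn C w) * l) < |∑ i, C.indicator e (w i)|} ≤
      2 * ENNReal.ofReal (Real.exp (-l)) := by
  have h1 := measure_sqrt_countIn_lt_sum_le (n := n) hC he hl h
  have h2 := measure_sqrt_countIn_lt_sum_le (n := n) hC he.neg hl fun t => by
    simpa using h (-t)
  rw [two_mul]
  refine (measure_mono fun w hw => ?_).trans
    ((measure_union_le _ _).trans (add_le_add h1 h2))
  rw [Set.mem_ofPred_eq] at hw
  rcases lt_abs.1 hw with hw | hw
  · exact Or.inl hw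
  · refine Or.inr ?_
    rw [← Finset.sum_neg_distrib] at hw
    refine hw.trans_eq (Finset.sum_congr rfl fun i _ => ?_)
    by_cases hi : w i ∈ C <;> simp [hi]

end Concentration

/-! ### Geometry and measurability of the Voronoi cells of a maximal net. -/

section Cells

variable {d m : ℕ} {η : ℝ} {z : Fin m → EuclideanSpace ℝ (Fin d)} {I : Finset (Fin m)}

lemma IsMaximalNet.exists_norm_sub_le (h : IsMaximalNet η z I) (hη : 0 ≤ η) (j : Fin m) :
    ∃ k ∈ I, ‖z j - z k‖ ≤ η := by
  by_contra! hcon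
  have hj : j ∉ I := fun hj => by
    have := hcon j hj
    simp only [sub_self, norm_zero] at this
    exact absurd this (not_lt.2 hη)
  have hsep : ∀ i ∈ insert j I, ∀ k ∈ insert j I, i ≠ k → η < ‖z i - z k‖ := by
    intro i hi k hk hik
    rcases Finset.mem_insert.1 hi with rfl | hi' <;> rcases Finset.mem_insert.1 hk with rfl | hk'
    · exact absurd rfl hik
    · exact hcon k hk'
    · rw [norm_sub_rev]; exact hcon i hi'
    · exact h.prop i hi' k hk' hik
  exact hj (h.le_of_ge hsep (Finset.subset_insert j I) (Finset.mem_insert_self j I))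

lemma exists_isNearestIndex (z : Fin m → EuclideanSpace ℝ (Fin d)) (hI : I.Nonempty)
    (x : EuclideanSpace ℝ (Fin d)) : ∃ k, IsNearestIndex z I x k := by
  -- The lexicographic order with the index dualized encodes the tie-breaking towards larger
  -- indices.
  obtain ⟨k, hk, hmin⟩ := I.exists_min_image
    (fun j => toLex (‖x - z j‖, OrderDual.toDual j)) hI
  refine ⟨k, hk, fun j hj => ?_⟩
  simpa [Prod.Lex.toLex_le_toLex] using hmin j hj

lemma IsNearestIndex.norm_sub_le {x : EuclideanSpace ℝ (Fin d)} {k j : Fin m}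
    (h : IsNearestIndex z I x k) (hj : j ∈ I) : ‖x - z k‖ ≤ ‖x - z j‖ :=
  (h.2 j hj).elim le_of_lt fun h => h.1.le

/-- A point of `S` close to a net point belongs to the cell of that net point. -/
lemma IsMaximalNet.inter_ball_subset_voronoiCell (h : IsMaximalNet η z I)
    {S : Set (EuclideanSpace ℝ (Fin d))} {x : EuclideanSpace ℝ (Fin d)} {k : Fin m}
    (hk : IsNearestIndex z I x k) :
    S ∩ Metric.ball (z k) (η / 2) ⊆ voronoiCell S z I x := by
  rintro y ⟨hyS, hy⟩
  rw [Metric.mem_ball, dist_eq_norm] at hy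
  refine ⟨hyS, k, hk, hk.1, fun j hj => ?_⟩
  rcases eq_or_ne j k with rfl | hjk
  · exact Or.inr ⟨rfl, le_rfl⟩
  -- Separation puts `y` at distance more than `η - η/2 = η/2` from every other net point.
  · have h1 := h.prop j hj k hk.1 hjk
    have h2 := norm_sub_le_norm_sub_add_norm_sub (z j) y (z k)
    rw [norm_sub_rev (z j) y] at h2
    exact Or.inl (by linarith)

lemma mem_voronoiCell_self (hI : I.Nonempty) {S : Set (EuclideanSpace ℝ (Fin d))}
    {x : EuclideanSpace ℝ (Fin d)} (hx : x ∈ S) : x ∈ voronoiCell S z I x := by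
  obtain ⟨k, hk⟩ := exists_isNearestIndex z hI x
  exact ⟨hx, k, hk, hk⟩

/-- If every point of `S` is within `τ` of a prototype, points of one cell are within `2 (η + τ)`
of each other. -/
lemma IsMaximalNet.norm_sub_le_of_mem_voronoiCell (h : IsMaximalNet η z I) (hη : 0 ≤ η)
    {S : Set (EuclideanSpace ℝ (Fin d))} {τ : ℝ} (hcov : ∀ y ∈ S, ∃ j, ‖y - z j‖ ≤ τ)
    {x y : EuclideanSpace ℝ (Fin d)} (hx : x ∈ S) (hy : y ∈ voronoiCell S z I x) :
    ‖x - y‖ ≤ 2 * (η + τ) := by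
  obtain ⟨hyS, k, hkx, hky⟩ := hy
  -- Two hops: from `u` to a prototype within `τ`, then by maximality to a net point within `η`; the
  -- nearest net point is no farther.
  have key : ∀ u ∈ S, IsNearestIndex z I u k → ‖u - z k‖ ≤ η + τ := by
    intro u hu hku
    obtain ⟨j, hj⟩ := hcov u hu
    obtain ⟨i, hi, hji⟩ := h.exists_norm_sub_le hη j
    have h1 := hku.norm_sub_le hi
    have h2 := norm_sub_le_norm_sub_add_norm_sub u (z j) (z i)
    linarith
  have h1 := key x hx hkx
  have h2 := key y hyS hky
  have h3 := norm_sub_le_norm_sub_add_norm_sub x (z k) y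
  rw [norm_sub_rev (z k) y] at h3
  linarith

lemma lipConst_nonneg (g : EuclideanSpace ℝ (Fin d) → ℝ) (V : Set (EuclideanSpace ℝ (Fin d))) :
    0 ≤ lipConst g V :=
  Real.sInf_nonneg fun _ hK => hK.1

/-- The infimum defining `lipConst` is itself a Lipschitz constant. The bound `L` makes the set of
constants nonempty; `max L 0` is used because `L` may be negative. -/
lemma abs_sub_le_lipConst_mul {g : EuclideanSpace ℝ (Fin d) → ℝ}
    {V : Set (EuclideanSpace ℝ (Fin d))} {L : ℝ}
    (hL : ∀ x ∈ V, ∀ y ∈ V, |g x - g y| ≤ L * ‖x - y‖) {x y : EuclideanSpace ℝ (Fin d)}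
    (hx : x ∈ V) (hy : y ∈ V) : |g x - g y| ≤ lipConst g V * ‖x - y‖ := by
  rcases eq_or_ne x y with rfl | hxy
  · simp
  have hpos : 0 < ‖x - y‖ := norm_pos_iff.2 (sub_ne_zero.2 hxy)
  rw [← div_le_iff₀ hpos]
  refine le_csInf ⟨max L 0, le_max_right _ _, fun u hu v hv => (hL u hu v hv).trans ?_⟩
    fun K hK => (div_le_iff₀ hpos).2 (hK.2 x hx y hy)
  exact mul_le_mul_of_nonneg_right (le_max_left _ _) (norm_nonneg _)

/-- The cell of `x` depends measurably on the prototypes. -/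
lemma measurableSet_mem_voronoiCell {S : Set (EuclideanSpace ℝ (Fin d))} (hS : MeasurableSet S)
    {net : (Fin m → EuclideanSpace ℝ (Fin d)) → Finset (Fin m)}
    (hnet : ∀ I, MeasurableSet {z | net z = I}) (x : EuclideanSpace ℝ (Fin d)) :
    MeasurableSet {p : EuclideanSpace ℝ (Fin d) × (Fin m → EuclideanSpace ℝ (Fin d)) |
      p.1 ∈ voronoiCell S p.2 (net p.2) x} := by
  have hnear : ∀ (u : EuclideanSpace ℝ (Fin d) × (Fin m → EuclideanSpace ℝ (Fin d)) →
      EuclideanSpace ℝ (Fin d)), Measurable u → ∀ (I : Finset (Fin m)) (k : Fin m),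
      MeasurableSet {p | IsNearestIndex p.2 I (u p) k} := by
    intro u hu I k
    have hn : ∀ j : Fin m, Measurable fun p : EuclideanSpace ℝ (Fin d) ×
        (Fin m → EuclideanSpace ℝ (Fin d)) => ‖u p - p.2 j‖ := fun j => by fun_prop
    simp only [IsNearestIndex, Set.ofPred_and, Set.ofPred_forall]
    refine (MeasurableSet.const _).inter (.iInter fun j => .iInter fun _ => ?_)
    rw [Set.ofPred_or, Set.ofPred_and]
    exact (measurableSet_lt (hn k) (hn j)).union
      ((measurableSet_eq_fun (hn k) (hn j)).inter (.const _))
  -- The net takes finitely many values, so the event is a finite union over its value and the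
  -- common nearest index.
  have heq : {p : EuclideanSpace ℝ (Fin d) × (Fin m → EuclideanSpace ℝ (Fin d)) |
      p.1 ∈ voronoiCell S p.2 (net p.2) x} = (Prod.fst ⁻¹' S) ∩
      ⋃ I, (Prod.snd ⁻¹' {z | net z = I}) ∩ ⋃ k, ({p | IsNearestIndex p.2 I x k} ∩
        {p | IsNearestIndex p.2 I p.1 k}) := by
    ext p
    simp [voronoiCell]
  rw [heq]
  exact (measurable_fst hS).inter (.iUnion fun I => (measurable_snd (hnet I)).inter
    (.iUnion fun k => (hnear _ measurable_const I k).inter (hnear _ measurable_fst I k)))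

end Cells

/-! ### Covering of the domain by the prototypes. -/

section Covering

variable {d m : ℕ}

lemma unitBallVolume_pos (d : ℕ) : 0 < unitBallVolume d :=
  ENNReal.toReal_pos (Metric.measure_ball_pos _ _ one_pos).ne' measure_ball_lt_top.ne

lemma CovariateAssumption.le_measure_inter_ball {PX : Measure (EuclideanSpace ℝ (Fin d))}
    {S : Set (EuclideanSpace ℝ (Fin d))} {ρ₀ c T₀ b M : ℝ} {f : EuclideanSpace ℝ (Fin d) → ℝ}
    (h : CovariateAssumption PX S ρ₀ c T₀ b M f) {x : EuclideanSpace ℝ (Fin d)} (hx : x ∈ S)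
    {τ : ℝ} (hτ : 0 < τ) (hτT : τ ≤ T₀) :
    ENNReal.ofReal (b * c * unitBallVolume d * τ ^ d) ≤ PX (S ∩ Metric.ball x τ) := by
  have hvol : volume.real (Metric.ball x τ) = τ ^ d * unitBallVolume d := by
    rw [measureReal_def, Measure.addHaar_ball_of_pos _ _ hτ, ENNReal.toReal_mul,
      ENNReal.toReal_ofReal (by positivity), finrank_euclideanSpace_fin]
    rfl
  have h1 := h.volume_inter_ball x hx τ hτ hτT
  have hm : MeasurableSet (S ∩ Metric.ball x τ) := h.measurableSet.inter measurableSet_ball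
  have hfin : volume (S ∩ Metric.ball x τ) ≠ ⊤ :=
    measure_ne_top_of_subset Set.inter_subset_right measure_ball_lt_top.ne
  rw [h.law_eq, withDensity_apply _ hm, Measure.restrict_restrict hm]
  calc ENNReal.ofReal (b * c * unitBallVolume d * τ ^ d)
      ≤ ENNReal.ofReal (b * volume.real (S ∩ Metric.ball x τ)) := by
        refine ENNReal.ofReal_le_ofReal ?_
        have := mul_le_mul_of_nonneg_left h1 h.b_pos.le
        rw [hvol] at this
        linarith
    _ = ENNReal.ofReal b * volume (S ∩ Metric.ball x τ ∩ S) := by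
        rw [ENNReal.ofReal_mul h.b_pos.le, ofReal_measureReal hfin,
          Set.inter_eq_left.2 (Set.inter_subset_left : S ∩ Metric.ball x τ ⊆ S)]
    _ = ∫⁻ _ in S ∩ Metric.ball x τ ∩ S, ENNReal.ofReal b := by simp
    _ ≤ _ := setLIntegral_mono' (hm.inter h.measurableSet) fun y hy =>
        ENNReal.ofReal_le_ofReal (h.density_bounds y hy.2).1

lemma CovariateAssumption.measure_compl {PX : Measure (EuclideanSpace ℝ (Fin d))}
    {S : Set (EuclideanSpace ℝ (Fin d))} {ρ₀ c T₀ b M : ℝ} {f : EuclideanSpace ℝ (Fin d) → ℝ}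
    (h : CovariateAssumption PX S ρ₀ c T₀ b M f) : PX Sᶜ = 0 := by
  rw [h.law_eq, withDensity_apply _ h.measurableSet.compl,
    Measure.restrict_restrict h.measurableSet.compl]
  simp

/-- A set all of whose balls of radius `r / 2` have mass at least `q` is covered by at most `1 / q`
balls of radius `r` centred in it. -/
lemma exists_finset_cover {E : Type*} [PseudoMetricSpace E] [MeasurableSpace E]
    [OpensMeasurableSpace E] {PX : Measure E} [IsProbabilityMeasure PX] {S : Set E} {r q : ℝ}
    (hr : 0 < r) (hq : 0 < q) (hmass : ∀ x ∈ S, ENNReal.ofReal q ≤ PX (Metric.ball x (r / 2))) :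
    ∃ F : Finset E, ↑F ⊆ S ∧ F.card * q ≤ 1 ∧ ∀ y ∈ S, ∃ p ∈ F, dist y p < r := by
  classical
  -- For an `r`-separated set the balls of radius `r / 2` are disjoint, which bounds its cardinality
  -- by `1 / q`; one of maximal cardinality must then be an `r`-cover.
  let good : Finset E → Prop := fun F => ↑F ⊆ S ∧ ∀ x ∈ F, ∀ y ∈ F, x ≠ y → r ≤ dist x y
  have hcard : ∀ F, good F → F.card * q ≤ 1 := by
    intro F hF
    have hd : Set.PairwiseDisjoint (↑F : Set E) fun p => Metric.ball p (r / 2) := by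
      intro x hx y hy hxy
      exact Metric.ball_disjoint_ball (by linarith [hF.2 x hx y hy hxy])
    have h1 : F.card * ENNReal.ofReal q ≤ 1 := by
      calc F.card * ENNReal.ofReal q = ∑ _p ∈ F, ENNReal.ofReal q := by simp
        _ ≤ ∑ p ∈ F, PX (Metric.ball p (r / 2)) :=
          Finset.sum_le_sum fun p hp => hmass p (hF.1 hp)
        _ = PX (⋃ p ∈ F, Metric.ball p (r / 2)) :=
          (measure_biUnion_finset hd fun _ _ => measurableSet_ball).symm
        _ ≤ 1 := prob_le_one
    rw [← ENNReal.ofReal_natCast, ← ENNReal.ofReal_mul (Nat.cast_nonneg _)] at h1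
    exact ENNReal.ofReal_le_one.1 h1
  have hbdd : BddAbove (Finset.card '' {F | good F}) := by
    refine ⟨⌊1 / q⌋₊, ?_⟩
    rintro _ ⟨F, hF, rfl⟩
    exact Nat.le_floor ((le_div_iff₀ hq).2 (hcard F hF))
  obtain ⟨F, hF, hmax⟩ := Nat.sSup_mem (s := Finset.card '' {F | good F})
    ⟨0, ∅, ⟨by simp, by simp⟩, rfl⟩ hbdd
  refine ⟨F, hF.1, hcard F hF, fun y hy => ?_⟩
  by_contra! hfar
  have hyF : y ∉ F := fun hyF => by
    have := hfar y hyF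
    rw [dist_self] at this
    linarith
  have hgood : good (insert y F) := by
    refine ⟨by rw [Finset.coe_insert]; exact Set.insert_subset hy hF.1, ?_⟩
    intro u hu v hv huv
    rcases Finset.mem_insert.1 hu with rfl | hu' <;> rcases Finset.mem_insert.1 hv with rfl | hv'
    · exact absurd rfl huv
    · exact hfar v hv'
    · rw [dist_comm]; exact hfar u hu'
    · exact hF.2 u hu' v hv' huv
  have := le_csSup hbdd ⟨_, hgood, rfl⟩
  rw [← hmax, Finset.card_insert_of_notMem hyF] at this
  omega

/-- The arithmetic of the union bound over `N` centres. With `l = log(12m/δ) ≥ 1`, the condition `κ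
τ^d ≤ 1` forces `4d ≤ m`, so `N ≤ (4d)^d / (κ τ^d) ≤ m^(d+1)`. The exponential equals
`(δ/(12m))^(16d)`, which absorbs this power of `m`. -/
lemma card_mul_exp_neg_le {N κ τ δ : ℝ} (hd : 1 ≤ d) (hm : 1 ≤ m) (hN : 0 ≤ N) (hδ₀ : 0 < δ)
    (hδ : δ < 1 / 4) (hκ : κ * τ ^ d = 32 * d * Real.log (12 * m / δ) / m)
    (hκ₁ : κ * τ ^ d ≤ 1) (hNκ : N * (κ * (τ / (2 * d) / 2) ^ d) ≤ 1) :
    N * Real.exp (-(m * (κ * τ ^ d / 2))) ≤ δ := by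
  have hm' : (1 : ℝ) ≤ m := by exact_mod_cast hm
  have hd' : (1 : ℝ) ≤ d := by exact_mod_cast hd
  set l := Real.log (12 * m / δ) with hl
  set w := δ / (12 * m) with hw
  have hw0 : 0 < w := by positivity
  have hmw : m * w ≤ δ := by
    rw [hw, show (m : ℝ) * (δ / (12 * m)) = δ / 12 by field_simp]; linarith
  have hw1 : w ≤ 1 := by nlinarith
  have hexpl : Real.exp (-l) = w := by
    rw [hl, Real.exp_neg, Real.exp_log (by positivity), inv_div]
  have hl1 : 1 ≤ l := by
    rw [hl, Real.le_log_iff_exp_le (by positivity)]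
    have h3 := Real.exp_one_lt_d9
    rw [le_div_iff₀ hδ₀]
    nlinarith
  have h4d : (4 * d : ℝ) ≤ m := by
    rw [hκ, div_le_one (by positivity)] at hκ₁
    nlinarith
  have hNm : N ≤ (m : ℝ) ^ (d + 1) := by
    have h1 : κ * (τ / (2 * d) / 2) ^ d = κ * τ ^ d / (4 * d : ℝ) ^ d := by
      rw [show τ / (2 * d) / 2 = τ / (4 * d : ℝ) by field_simp; norm_num, div_pow]
      ring
    have h2 : 1 / (m : ℝ) ≤ κ * τ ^ d := by
      rw [hκ]; gcongr; nlinarith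
    have h3 : 1 / (m : ℝ) / (m : ℝ) ^ d ≤ κ * (τ / (2 * d) / 2) ^ d := by
      have h0 : 0 ≤ κ * τ ^ d := le_trans (by positivity) h2
      rw [h1]
      gcongr
    have h4 : N * (1 / (m : ℝ) / (m : ℝ) ^ d) ≤ 1 :=
      (mul_le_mul_of_nonneg_left h3 hN).trans hNκ
    rw [div_div, mul_one_div, div_le_one (by positivity)] at h4
    rw [pow_succ']
    exact h4
  have hexp : Real.exp (-(m * (κ * τ ^ d / 2))) = w ^ (16 * d) := by
    rw [← hexpl, ← Real.exp_nat_mul, hκ]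
    congr 1
    push_cast
    field_simp
    ring
  rw [hexp]
  calc N * w ^ (16 * d) ≤ (m : ℝ) ^ (d + 1) * w ^ (d + 1) :=
        mul_le_mul hNm (pow_le_pow_of_le_one hw0.le hw1 (by omega)) (by positivity)
          (by positivity)
    _ = (m * w) ^ (d + 1) := (mul_pow _ _ _).symm
    _ ≤ (m * w) ^ 1 := pow_le_pow_of_le_one (by positivity) (by linarith) (by omega)
    _ ≤ δ := by rw [pow_one]; exact hmw

/-- With probability at least `1 - δ`, every point of `S` is within `τ` of a prototype. -/
lemma CovariateAssumption.measure_not_cover_le {PX : Measure (EuclideanSpace ℝ (Fin d))}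
    [IsProbabilityMeasure PX] {S : Set (EuclideanSpace ℝ (Fin d))} {ρ₀ c T₀ b M : ℝ}
    {f : EuclideanSpace ℝ (Fin d) → ℝ} (h : CovariateAssumption PX S ρ₀ c T₀ b M f)
    (hd : 1 ≤ d) (hm : 1 ≤ m) {δ τ : ℝ} (hδ₀ : 0 < δ) (hδ : δ < 1 / 4) (hτ : 0 < τ)
    (hτT : τ ≤ T₀)
    (hτd : b * c * unitBallVolume d * τ ^ d = 32 * d * Real.log (12 * m / δ) / m)
    (hS : S.Nonempty) :
    (Measure.pi fun _ : Fin m => PX) {z | ¬ ∀ y ∈ S, ∃ j, ‖y - z j‖ ≤ τ} ≤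
      ENNReal.ofReal δ := by
  have hd' : (1 : ℝ) ≤ d := by exact_mod_cast hd
  have hV := unitBallVolume_pos d
  have hb := h.b_pos
  have hc := h.c_pos
  set κ := b * c * unitBallVolume d with hκ
  have hκ0 : 0 < κ := by positivity
  have hmass : ∀ x ∈ S, ∀ t, 0 < t → t ≤ T₀ →
      ENNReal.ofReal (κ * t ^ d) ≤ PX (Metric.ball x t) := fun x hx t ht htT =>
    (h.le_measure_inter_ball hx ht htT).trans (measure_mono Set.inter_subset_right)
  -- The left side bounds from below the probability of a ball centred at a point of `S`.
  have hκ₁ : κ * τ ^ d ≤ 1 := by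
    obtain ⟨x, hx⟩ := hS
    exact ENNReal.ofReal_le_one.1 ((hmass x hx τ hτ hτT).trans prob_le_one)
  have hrτ : τ / (2 * d) ≤ τ / 2 := by gcongr; linarith
  -- The mesh `τ/(2d)` is fine enough that balls of the remaining radius `t = τ(1 - 1/(2d))` keep
  -- half of the mass bound: `(1 - 1/(2d))^d ≥ 1/2` by Bernoulli. If `y` has no prototype within
  -- `τ`, a centre near `y` has none within `t`.
  obtain ⟨F, hFS, hFcard, hF⟩ := exists_finset_cover (PX := PX) (S := S) (r := τ / (2 * d))
    (q := κ * (τ / (2 * d) / 2) ^ d) (by positivity) (by positivity) fun x hx =>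
      hmass x hx _ (by positivity) (by linarith)
  set t := τ * (1 - 1 / (2 * d)) with ht
  have htτ : τ / (2 * d) + t = τ := by rw [ht]; field_simp; ring
  have ht0 : 0 < t := by linarith
  have hone : ∀ p ∈ F, (Measure.pi fun _ : Fin m => PX) (Set.univ.pi fun _ =>
      (Metric.ball p t)ᶜ) ≤ ENNReal.ofReal (Real.exp (-(m * (κ * τ ^ d / 2)))) := by
    intro p hp
    have h0 : 0 < τ / (2 * (d : ℝ)) := by positivity
    have hle : κ * τ ^ d / 2 ≤ PX.real (Metric.ball p t) := by
      have hmp := (ENNReal.ofReal_le_iff_le_toReal (measure_ne_top _ _)).1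
        (hmass p (hFS hp) t ht0 (by linarith))
      refine le_trans ?_ hmp
      have hbern := one_add_mul_le_pow (a := -(1 / (2 * (d : ℝ)))) (by
        have : 1 / (2 * (d : ℝ)) ≤ 1 := by rw [div_le_one (by positivity)]; linarith
        linarith) d
      have heq : 1 + (d : ℝ) * -(1 / (2 * d)) = 1 / 2 := by field_simp; ring
      rw [heq, ← sub_eq_add_neg] at hbern
      rw [ht, mul_pow]
      have : 0 ≤ κ * τ ^ d := by positivity
      nlinarith
    rw [Measure.pi_pi, Finset.prod_const, Finset.card_univ, Fintype.card_fin,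
      ← ofReal_measureReal, ← ENNReal.ofReal_pow (by positivity),
      probReal_compl_eq_one_sub measurableSet_ball]
    refine ENNReal.ofReal_le_ofReal ?_
    rw [← mul_neg, Real.exp_nat_mul]
    have h1 : PX.real (Metric.ball p t) ≤ 1 := measureReal_le_one
    refine pow_le_pow_left₀ (by linarith) ?_ m
    have := Real.one_sub_le_exp_neg (κ * τ ^ d / 2)
    linarith
  have hsub : {z : Fin m → EuclideanSpace ℝ (Fin d) | ¬ ∀ y ∈ S, ∃ j, ‖y - z j‖ ≤ τ} ⊆
      ⋃ p ∈ F, Set.univ.pi fun _ => (Metric.ball p t)ᶜ := by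
    intro z hz
    rw [Set.mem_ofPred_eq] at hz
    push Not at hz
    obtain ⟨y, hy, hyz⟩ := hz
    obtain ⟨p, hp, hyp⟩ := hF y hy
    refine Set.mem_iUnion₂.2 ⟨p, hp, fun j _ hj => ?_⟩
    rw [Metric.mem_ball] at hj
    have h1 := hyz j
    rw [← dist_eq_norm] at h1
    have h2 := dist_triangle_right y (z j) p
    linarith
  calc (Measure.pi fun _ : Fin m => PX) {z | ¬ ∀ y ∈ S, ∃ j, ‖y - z j‖ ≤ τ}
      ≤ ∑ p ∈ F, (Measure.pi fun _ : Fin m => PX) (Set.univ.pi fun _ => (Metric.ball p t)ᶜ) :=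
        (measure_mono hsub).trans (measure_biUnion_finset_le _ _)
    _ ≤ ∑ _p ∈ F, ENNReal.ofReal (Real.exp (-(m * (κ * τ ^ d / 2)))) := Finset.sum_le_sum hone
    _ = ENNReal.ofReal (F.card * Real.exp (-(m * (κ * τ ^ d / 2)))) := by
      rw [Finset.sum_const, nsmul_eq_mul, ENNReal.ofReal_mul (Nat.cast_nonneg _),
        ENNReal.ofReal_natCast]
    _ ≤ ENNReal.ofReal δ := ENNReal.ofReal_le_ofReal
      (card_mul_exp_neg_le hd hm (Nat.cast_nonneg _) hδ₀ hδ hτd hκ₁ hFcard)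

end Covering

/-! ### Noise transfer, bias-variance decomposition and integration over the prototypes. -/

section Estimator

variable {d n m : ℕ}

/-- The function `g` need not be measurable off `S`, so the noise is written with `S.indicator g`,
which agrees with `g` on every cell. -/
lemma measurable_indicator_of_lipschitz {S : Set (EuclideanSpace ℝ (Fin d))}
    (hS : MeasurableSet S) {g : EuclideanSpace ℝ (Fin d) → ℝ} {L : ℝ}
    (hL : ∀ x ∈ S, ∀ y ∈ S, |g x - g y| ≤ L * ‖x - y‖) : Measurable (S.indicator g) := by
  classical
  have hlip : LipschitzOnWith L.toNNReal g S := by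
    refine LipschitzOnWith.of_dist_le_mul fun x hx y hy => ?_
    rw [Real.dist_eq, dist_eq_norm]
    exact (hL x hx y hy).trans
      (mul_le_mul_of_nonneg_right (Real.le_coe_toNNReal L) (norm_nonneg _))
  rw [← Set.piecewise_eq_indicator]
  exact hlip.continuousOn.measurable_piecewise continuousOn_const hS

/-- Conditional sub-Gaussianity given a pair bounds the Laplace transform of the noise on events
determined by the first component, in terms of the law `P` of a labelled observation. -/
lemma CondSubGaussian.setLIntegral_exp_le {Ω F : Type*} [MeasurableSpace Ω] [MeasurableSpace F]
    {μ : Measure Ω} [IsProbabilityMeasure μ] {X : Ω → EuclideanSpace ℝ (Fin d)} {Y : Ω → ℝ}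
    {Z : Ω → F} (hX : Measurable X) (hY : Measurable Y) (hZ : Measurable Z)
    {S V : Set (EuclideanSpace ℝ (Fin d))} (hV : MeasurableSet V) (hVS : V ⊆ S)
    {g : EuclideanSpace ℝ (Fin d) → ℝ} (hg : Measurable (S.indicator g)) {σ : ℝ}
    (h : CondSubGaussian μ (MeasurableSpace.comap (fun ω => (X ω, Z ω)) inferInstance)
      (fun ω => Y ω - g (X ω)) σ) (t : ℝ) :
    ∫⁻ p in Prod.fst ⁻¹' V, ENNReal.ofReal (Real.exp (t * (p.2 - S.indicator g p.1)))
        ∂(μ.map fun ω => (X ω, Y ω)) ≤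
      ENNReal.ofReal (Real.exp (σ ^ 2 * t ^ 2 / 2)) *
        (μ.map fun ω => (X ω, Y ω)) (Prod.fst ⁻¹' V) := by
  obtain ⟨-, -, h⟩ := h
  obtain ⟨hint, hle⟩ := h t
  have hXY : Measurable fun ω => (X ω, Y ω) := hX.prodMk hY
  have hVm : MeasurableSet (Prod.fst ⁻¹' V : Set (EuclideanSpace ℝ (Fin d) × ℝ)) :=
    measurable_fst hV
  have hcomap : MeasurableSpace.comap (fun ω => (X ω, Z ω)) inferInstance ≤ ‹MeasurableSpace Ω› :=
    (hX.prodMk hZ).comap_le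
  rw [setLIntegral_map hVm (by fun_prop) hXY, Measure.map_apply hXY hVm]
  change ∫⁻ ω in X ⁻¹' V, _ ∂μ ≤ _ * μ (X ⁻¹' V)
  -- The event `X ∈ V` lies in the conditioning σ-algebra, so the conditional bound can be
  -- integrated over it.
  have hset : MeasurableSet[MeasurableSpace.comap (fun ω => (X ω, Z ω)) inferInstance]
      (X ⁻¹' V) := ⟨Prod.fst ⁻¹' V, measurable_fst hV, rfl⟩
  calc ∫⁻ ω in X ⁻¹' V, ENNReal.ofReal (Real.exp (t * (Y ω - S.indicator g (X ω)))) ∂μ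
      = ∫⁻ ω in X ⁻¹' V, ENNReal.ofReal (Real.exp (t * (Y ω - g (X ω)))) ∂μ :=
        setLIntegral_congr_fun (hX hV) fun ω hω => by
          simp only [Set.indicator_of_mem (hVS hω)]
    _ = ENNReal.ofReal (∫ ω in X ⁻¹' V, Real.exp (t * (Y ω - g (X ω))) ∂μ) :=
        (ofReal_integral_eq_lintegral_ofReal hint.integrableOn
          (Filter.Eventually.of_forall fun _ => Real.exp_nonneg _)).symm
    _ ≤ ENNReal.ofReal (∫ _ in X ⁻¹' V, Real.exp (σ ^ 2 * t ^ 2 / 2) ∂μ) := by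
        rw [← setIntegral_condExp hcomap hint hset]
        exact ENNReal.ofReal_le_ofReal (setIntegral_mono_ae integrable_condExp.integrableOn
          (integrable_const _).integrableOn hle)
    _ = _ := by
        rw [setIntegral_const, smul_eq_mul, mul_comm, ENNReal.ofReal_mul (Real.exp_nonneg _),
          ofReal_measureReal]

/-- The bias-variance decomposition of a local average. -/
lemma abs_localAverage_sub_le {x : Fin n → EuclideanSpace ℝ (Fin d)} {y : Fin n → ℝ}
    {V : Set (EuclideanSpace ℝ (Fin d))} {h : EuclideanSpace ℝ (Fin d) → ℝ} {r a v D : ℝ}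
    (ha : 0 < a) (hv : 0 ≤ v) (hN : a ≤ ∑ i, V.indicator (fun _ => (1 : ℝ)) (x i))
    (hnoise : |∑ i, V.indicator (fun _ => y i - h (x i)) (x i)| ≤
      √(v * ∑ i, V.indicator (fun _ => (1 : ℝ)) (x i)))
    (hbias : ∀ u ∈ V, |h u - r| ≤ D) : |localAverage x y V - r| ≤ √(v / a) + D := by
  unfold localAverage
  set N := ∑ i, V.indicator (fun _ => (1 : ℝ)) (x i) with hNdef
  have hN0 : 0 < N := ha.trans_le hN
  have hsplit : (∑ i, V.indicator (fun _ => y i) (x i)) / N - r =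
      (∑ i, V.indicator (fun _ => y i - h (x i)) (x i)) / N +
        (∑ i, V.indicator (fun _ => h (x i) - r) (x i)) / N := by
    rw [← add_div, ← Finset.sum_add_distrib, eq_div_iff hN0.ne', sub_mul,
      div_mul_cancel₀ _ hN0.ne', hNdef, Finset.mul_sum, ← Finset.sum_sub_distrib]
    refine Finset.sum_congr rfl fun i _ => ?_
    by_cases hi : x i ∈ V <;> simp [hi]
  have h1 : |(∑ i, V.indicator (fun _ => y i - h (x i)) (x i)) / N| ≤ √(v / a) := by
    rw [abs_div, abs_of_pos hN0, div_le_iff₀ hN0]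
    refine hnoise.trans ?_
    rw [Real.sqrt_le_left (by positivity), mul_pow, Real.sq_sqrt (by positivity)]
    have : v / N ≤ v / a := by gcongr
    calc v * N = v / N * N ^ 2 := by field_simp
      _ ≤ _ := by gcongr
  have h2 : |(∑ i, V.indicator (fun _ => h (x i) - r) (x i)) / N| ≤ D := by
    rw [abs_div, abs_of_pos hN0, div_le_iff₀ hN0, hNdef, Finset.mul_sum]
    refine (Finset.abs_sum_le_sum_abs _ _).trans (Finset.sum_le_sum fun i _ => ?_)
    by_cases hi : x i ∈ V
    · simpa [hi] using hbias _ hi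
    · simp [hi]
  rw [hsplit]
  exact (abs_add_le _ _).trans (add_le_add h1 h2)

/-- For a sample with law `P`, on a random set `C z` of mass at least `p` for almost every `z`, the
count is at least half of `n p` and the noise is controlled, outside an event of small
probability. -/
lemma exists_measurableSet_count_and_noise {α F : Type*} [MeasurableSpace α] [MeasurableSpace F]
    {P : Measure α} [IsProbabilityMeasure P] {ν : Measure F} [IsProbabilityMeasure ν]
    {C : F → Set α} (hC : MeasurableSet {q : α × F | q.1 ∈ C q.2}) {p : ℝ} (hp : 0 ≤ p)
    (hpC : ∀ᵐ z ∂ν, ENNReal.ofReal p ≤ P (C z)) {e : α → ℝ} (he : Measurable e) {σ δ : ℝ}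
    (hδ₀ : 0 < δ) (hδ₁ : δ ≤ 1)
    (hnoise : ∀ z, ∀ t : ℝ, ∫⁻ x in C z, ENNReal.ofReal (Real.exp (t * e x)) ∂P ≤
      ENNReal.ofReal (Real.exp (σ ^ 2 * t ^ 2 / 2)) * P (C z))
    (hn : 8 * Real.log (1 / δ) ≤ n * p) :
    ∃ B : Set ((Fin n → α) × F), MeasurableSet B ∧
      ((Measure.pi fun _ : Fin n => P).prod ν) B ≤ 3 * ENNReal.ofReal δ ∧ ∀ q ∉ B,
        n * p / 2 ≤ countIn (C q.2) q.1 ∧ |∑ i, (C q.2).indicator e (q.1 i)| ≤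
          √(2 * (σ ^ 2 * countIn (C q.2) q.1) * Real.log (1 / δ)) := by
  set l := Real.log (1 / δ) with hl
  have hl0 : 0 ≤ l := Real.log_nonneg (by rw [le_div_iff₀ hδ₀]; linarith)
  have hexp : Real.exp (-l) = δ := by
    rw [hl, Real.exp_neg, Real.exp_log (by positivity), one_div, inv_inv]
  have hsum : ∀ u : α → ℝ, Measurable u →
      Measurable fun q : (Fin n → α) × F => ∑ i, (C q.2).indicator u (q.1 i) := by
    intro u hu
    refine Finset.measurable_sum _ fun i _ => ?_
    have hi : Measurable fun q : (Fin n → α) × F => (q.1 i, q.2) := by fun_prop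
    exact ((hu.comp measurable_fst).indicator hC).comp hi
  have hcount : Measurable fun q : (Fin n → α) × F => countIn (C q.2) q.1 :=
    hsum _ measurable_const
  have hCm : ∀ z, MeasurableSet (C z) := fun z =>
    (measurable_id.prodMk measurable_const : Measurable fun a : α => (a, z)) hC
  let B : Set ((Fin n → α) × F) := {q | countIn (C q.2) q.1 < n * p / 2} ∪
    {q | √(2 * (σ ^ 2 * countIn (C q.2) q.1) * l) < |∑ i, (C q.2).indicator e (q.1 i)|}
  have hB : MeasurableSet B := (measurableSet_lt hcount measurable_const).union
    (measurableSet_lt (by fun_prop) (hsum e he).abs)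
  refine ⟨B, hB, ?_, fun q hq => ?_⟩
  -- Fubini: for fixed `z` the set `C z` is deterministic, and the two bounds cost `δ` and `2δ`.
  · rw [Measure.prod_apply_symm hB]
    calc ∫⁻ z, (Measure.pi fun _ : Fin n => P) ((fun w => (w, z)) ⁻¹' B) ∂ν
        ≤ ∫⁻ _, 3 * ENNReal.ofReal δ ∂ν := by
          refine lintegral_mono_ae (hpC.mono fun z hz => ?_)
          have h1 := measure_countIn_lt_le (n := n) (hCm z) hp hz
          have h2 := measure_sqrt_countIn_lt_abs_sum_le (n := n) (hCm z) he hl0 (hnoise z)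
          have h3 : ENNReal.ofReal (Real.exp (-(n * p / 8))) ≤ ENNReal.ofReal δ := by
            refine ENNReal.ofReal_le_ofReal ?_
            rw [← hexp]
            exact Real.exp_le_exp.2 (by linarith)
          rw [hexp] at h2
          rw [show (3 : ENNReal) = 1 + 2 by norm_num, add_mul, one_mul]
          exact (measure_union_le _ _).trans (add_le_add (h1.trans h3) h2)
      _ = 3 * ENNReal.ofReal δ := by simp
  · simp only [B, Set.mem_union, Set.mem_ofPred_eq, not_or, not_lt] at hq
    exact hq

end Estimator

end OptiNet

/-! ### Assembly of the bound. -/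

theorem mainTheorem7
    {Ω : Type*} [MeasurableSpace Ω] (μ : Measure Ω) [IsProbabilityMeasure μ]
    (d n m : ℕ) (hd : 1 ≤ d) (hn : 1 ≤ n) (hm : 1 ≤ m)
    -- the labelled sample, the prototypes, and the law of a labelled observation
    (X : Fin n → Ω → EuclideanSpace ℝ (Fin d)) (Y : Fin n → Ω → ℝ)
    (Z : Fin m → Ω → EuclideanSpace ℝ (Fin d))
    (P : Measure (EuclideanSpace ℝ (Fin d) × ℝ))
    (hX : ∀ i, Measurable (X i)) (hY : ∀ i, Measurable (Y i)) (hZ : ∀ j, Measurable (Z j))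
    (hXY_law : ∀ i, μ.map (fun ω => (X i ω, Y i ω)) = P)
    (hXY_indep : iIndepFun (fun i ω => (X i ω, Y i ω)) μ)
    (hZ_law : ∀ j, μ.map (Z j) = P.fst)
    (hZ_indep : iIndepFun Z μ)
    (hXYZ_indep : IndepFun (fun ω i => (X i ω, Y i ω)) (fun ω j => Z j ω) μ)
    -- the domain and the law of the covariates
    (S : Set (EuclideanSpace ℝ (Fin d))) (ρ₀ c T₀ b M : ℝ)
    (f : EuclideanSpace ℝ (Fin d) → ℝ)
    (hXZ : OptiNet.CovariateAssumption P.fst S ρ₀ c T₀ b M f)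
    -- the regression function and the noise
    (g : EuclideanSpace ℝ (Fin d) → ℝ) (hg : OptiNet.IsRegressionFunction P g)
    (L : ℝ) (hL : ∀ x ∈ S, ∀ y ∈ S, |g x - g y| ≤ L * ‖x - y‖)
    (σ : ℝ)
    (hε : ∀ i, OptiNet.CondSubGaussian μ
      (MeasurableSpace.comap (fun ω => (X i ω, fun j => Z j ω)) inferInstance)
      (fun ω => Y i ω - g (X i ω)) σ)
    -- the rule selecting a maximal net of the prototypes
    (η : ℝ) (hη : 0 < η)
    (net : (Fin m → EuclideanSpace ℝ (Fin d)) → Finset (Fin m))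
    (hnet_meas : ∀ I, MeasurableSet {z | net z = I})
    (hnet : ∀ z, OptiNet.IsMaximalNet η z (net z))
    (δ : ℝ) (hδ₀ : 0 < δ) (hδ : δ < 1 / 4)
    (h_m : 32 * d * Real.log (12 * m / δ) ≤ T₀ ^ d * m * b * c * OptiNet.unitBallVolume d)
    (h_η : η ≤ 2 * T₀)
    (h_n : 2 ^ (d + 3) * Real.log (1 / δ) ≤ n * b * OptiNet.unitBallVolume d * c * η ^ d) :
    ∀ x ∈ S, ∃ A : Set Ω, MeasurableSet A ∧ ENNReal.ofReal (1 - 4 * δ) ≤ μ A ∧ ∀ ω ∈ A,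
      |OptiNet.localAverage (fun i => X i ω) (fun i => Y i ω)
          (OptiNet.voronoiCell S (fun j => Z j ω) (net fun j => Z j ω) x) - g x|
        ≤ Real.sqrt (2 ^ (d + 2) * σ ^ 2 * Real.log (1 / δ) /
              (n * b * OptiNet.unitBallVolume d * c * η ^ d))
          + 2 * OptiNet.lipConst g (OptiNet.voronoiCell S (fun j => Z j ω) (net fun j => Z j ω) x)
            * (η + (32 * d * Real.log (12 * m / δ) /
                (m * b * c * OptiNet.unitBallVolume d)) ^ ((1 : ℝ) / d)) := by
  have hm' : (1 : ℝ) ≤ m := by exact_mod_cast hm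
  have hb := hXZ.b_pos
  have hc := hXZ.c_pos
  have hV := OptiNet.unitBallVolume_pos d
  have hT := hXZ.T₀_pos
  intro x hx
  have hXYm : Measurable fun ω i => (X i ω, Y i ω) :=
    measurable_pi_lambda _ fun i => (hX i).prodMk (hY i)
  have hZm : Measurable fun ω j => Z j ω := measurable_pi_lambda _ hZ
  have hP : IsProbabilityMeasure P := by
    rw [← hXY_law ⟨0, hn⟩]
    exact Measure.isProbabilityMeasure_map ((hX _).prodMk (hY _)).aemeasurable
  have hQ : μ.map (fun ω i => (X i ω, Y i ω)) = Measure.pi fun _ : Fin n => P := by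
    rw [hXY_indep.map_fun_eq_pi_map fun i => ((hX i).prodMk (hY i)).aemeasurable]
    simp_rw [hXY_law]
  have hR : μ.map (fun ω j => Z j ω) = Measure.pi fun _ : Fin m => P.fst := by
    rw [hZ_indep.map_fun_eq_pi_map fun j => (hZ j).aemeasurable]
    simp_rw [hZ_law]
  have hQR : μ.map (fun ω => ((fun i => (X i ω, Y i ω)), fun j => Z j ω)) =
      (Measure.pi fun _ : Fin n => P).prod (Measure.pi fun _ : Fin m => P.fst) := by
    rw [← hQ, ← hR]
    exact hXYZ_indep.map_prod_eq_prod_map_map hXYm.aemeasurable hZm.aemeasurable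
  -- the covering event
  set a := 32 * d * Real.log (12 * m / δ) / (m * b * c * OptiNet.unitBallVolume d) with ha
  have hlog : 0 < Real.log (12 * m / δ) := Real.log_pos (by rw [lt_div_iff₀ hδ₀]; linarith)
  have ha0 : 0 < a := by positivity
  set τ := a ^ ((1 : ℝ) / d) with hτ
  have hτ0 : 0 < τ := by positivity
  have hτd : τ ^ d = a := by
    rw [hτ, one_div, Real.rpow_inv_natCast_pow ha0.le (by omega)]
  have hτT : τ ≤ T₀ := by
    refine le_of_pow_le_pow_left₀ (n := d) (by omega) hT.le ?_
    rw [hτd, ha, div_le_iff₀ (by positivity)]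
    linarith
  have hcover := hXZ.measure_not_cover_le hd hm hδ₀ hδ hτ0 hτT (by
    rw [hτd, ha]; field_simp) ⟨x, hx⟩
  -- Failure of covering involves uncountably many `y`; a measurable hull of the same measure avoids
  -- having to prove it measurable.
  set U := toMeasurable (Measure.pi fun _ : Fin m => P.fst)
    {z | ¬ ∀ y ∈ S, ∃ j, ‖y - z j‖ ≤ τ}
  -- the mass of the cell
  have hnonempty : ∀ z, (net z).Nonempty := fun z => by
    obtain ⟨k, hk, -⟩ := (hnet z).exists_norm_sub_le hη.le ⟨0, hm⟩
    exact ⟨k, hk⟩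
  set p := b * c * OptiNet.unitBallVolume d * (η / 2) ^ d with hp
  have hp0 : 0 < p := by positivity
  have hcellm := OptiNet.measurableSet_mem_voronoiCell hXZ.measurableSet hnet_meas x
  have hVm : ∀ z, MeasurableSet (OptiNet.voronoiCell S z (net z) x) := fun z =>
    (measurable_id.prodMk measurable_const :
      Measurable fun y : EuclideanSpace ℝ (Fin d) => (y, z)) hcellm
  have hVS : ∀ z, OptiNet.voronoiCell S z (net z) x ⊆ S := fun z y hy => hy.1
  have hmass : ∀ᵐ z ∂(Measure.pi fun _ : Fin m => P.fst),
      ENNReal.ofReal p ≤ P (Prod.fst ⁻¹' OptiNet.voronoiCell S z (net z) x) := by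
    -- The mass bound for balls needs centres in `S`, which the prototypes are only almost surely.
    have hzS : ∀ᵐ z ∂(Measure.pi fun _ : Fin m => P.fst), ∀ j, z j ∈ S := by
      refine ae_all_iff.2 fun j => ?_
      have hS : ∀ᵐ y ∂P.fst, y ∈ S := hXZ.measure_compl
      exact (measurePreserving_eval (fun _ : Fin m => P.fst) j).quasiMeasurePreserving.ae hS
    filter_upwards [hzS] with z hz
    obtain ⟨k, hk⟩ := OptiNet.exists_isNearestIndex z (hnonempty z) x
    rw [← Measure.fst_apply (hVm z)]
    exact (hXZ.le_measure_inter_ball (hz k) (half_pos hη) (by linarith)).trans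
      (measure_mono ((hnet z).inter_ball_subset_voronoiCell hk))
  have hnp : n * p = n * b * OptiNet.unitBallVolume d * c * η ^ d / 2 ^ d := by
    rw [hp, div_pow]; ring
  have hgm := OptiNet.measurable_indicator_of_lipschitz hXZ.measurableSet hL
  obtain ⟨B, hBm, hB, hgood⟩ := OptiNet.exists_measurableSet_count_and_noise (n := n) (σ := σ)
    (δ := δ) (P := P) (ν := Measure.pi fun _ : Fin m => P.fst)
    (C := fun z => Prod.fst ⁻¹' OptiNet.voronoiCell S z (net z) x)
    (((measurable_fst.comp measurable_fst).prodMk measurable_snd) hcellm) hp0.le hmass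
    (e := fun q => q.2 - S.indicator g q.1) (by fun_prop) hδ₀ (by linarith)
    (fun z t => by
      have := (hε ⟨0, hn⟩).setLIntegral_exp_le (hX _) (hY _) hZm (hVm z) (hVS z) hgm t
      rwa [hXY_law] at this)
    (by
      rw [hnp, le_div_iff₀ (by positivity)]
      rw [pow_add] at h_n
      linarith)
  refine ⟨((fun ω => ((fun i => (X i ω, Y i ω)), fun j => Z j ω)) ⁻¹' B ∪
    (fun ω j => Z j ω) ⁻¹' U)ᶜ, ?_, ?_, ?_⟩
  · exact (((hXYm.prodMk hZm) hBm).union (hZm (measurableSet_toMeasurable _ _))).compl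
  · rw [prob_compl_eq_one_sub
      (((hXYm.prodMk hZm) hBm).union (hZm (measurableSet_toMeasurable _ _))),
      ENNReal.ofReal_sub _ (by positivity), ENNReal.ofReal_one]
    refine tsub_le_tsub_left ((measure_union_le _ _).trans ?_) 1
    rw [← Measure.map_apply (hXYm.prodMk hZm) hBm, hQR,
      ← Measure.map_apply hZm (measurableSet_toMeasurable _ _), hR, measure_toMeasurable]
    refine (add_le_add hB hcover).trans_eq ?_
    rw [ENNReal.ofReal_mul (by norm_num), show ENNReal.ofReal 4 = 3 + 1 by norm_num, add_mul,
      one_mul]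
  · intro ω hω
    simp only [Set.compl_union, Set.mem_inter_iff, Set.mem_compl_iff, Set.mem_preimage] at hω
    obtain ⟨hωB, hωU⟩ := hω
    obtain ⟨hcount, hnoise⟩ := hgood _ hωB
    have hcov : ∀ y ∈ S, ∃ j, ‖y - Z j ω‖ ≤ τ :=
      not_not.1 fun hcon => hωU (subset_toMeasurable _ _ hcon)
    set z := fun j => Z j ω
    set V := OptiNet.voronoiCell S z (net z) x
    have hxV : x ∈ V := OptiNet.mem_voronoiCell_self (hnonempty z) hx
    have hl0 : 0 ≤ Real.log (1 / δ) := Real.log_nonneg (by rw [le_div_iff₀ hδ₀]; linarith)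
    have hcnt : OptiNet.countIn (Prod.fst ⁻¹' V) (fun i => (X i ω, Y i ω)) =
        ∑ i, V.indicator (fun _ => (1 : ℝ)) (X i ω) := rfl
    -- Here `v / a = 4σ² log(1/δ) / (n p)`, and `p` carries a factor `2^(-d)`: this is the constant
    -- `2^(d+2)`.
    have hres := OptiNet.abs_localAverage_sub_le (x := fun i => X i ω) (y := fun i => Y i ω)
      (V := V) (h := g) (r := g x) (a := n * p / 2) (v := 2 * σ ^ 2 * Real.log (1 / δ))
      (D := 2 * OptiNet.lipConst g V * (η + τ)) (by positivity) (by positivity)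
      (by rw [← hcnt]; exact hcount)
      (by
        have h1 : ∑ i, (Prod.fst ⁻¹' V).indicator (fun q : EuclideanSpace ℝ (Fin d) × ℝ =>
            q.2 - S.indicator g q.1) (X i ω, Y i ω) =
            ∑ i, V.indicator (fun _ => Y i ω - g (X i ω)) (X i ω) := by
          refine Finset.sum_congr rfl fun i _ => ?_
          by_cases hi : X i ω ∈ V
          · simp [hi, hVS z hi]
          · simp [hi]
        rw [← h1, ← hcnt]
        refine hnoise.trans_eq ?_
        congr 1
        ring)
      (fun u hu => by
        have h1 := OptiNet.abs_sub_le_lipConst_mul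
          (fun y hy y' hy' => hL y (hVS z hy) y' (hVS z hy')) hxV hu
        have h2 := (hnet z).norm_sub_le_of_mem_voronoiCell hη.le hcov hx hu
        rw [abs_sub_comm]
        have h3 := mul_le_mul_of_nonneg_left h2 (OptiNet.lipConst_nonneg g V)
        linarith)
    refine hres.trans_eq ?_
    congr 2
    rw [hnp, pow_add]
    field_simp
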